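/- Let $L^2(\partial\mathbb D)$ be taken with normalized Lebesgue measure and let $H^2\subset L^2(\partial\mathbb D)$ be the Hardy space (functions whose Fourier coefficients of negative index vanish). For a finite Blaschke product $\alpha(z)=c\prod_{j=1}^m\frac{z-a_j}{1-\overline{a_j}z}$ ($|c|=1$, $|a_j|<1$) let $K_\alpha=H^2\ominus\alpha H^2$ be the model space, $P_\alpha$ the orthogonal projection of $L^2(\partial\mathbb D)$ onto $K_\alpha$, $C_\alpha f(z)=\alpha(z)\overline{z}\,\overline{f(z)}$ ($|z|=1$) the conjugation on $K_\alpha$, $k_0^\alpha(z)=1-\overline{\alpha(0)}\alpha(z)$ and $\widetilde k_0^\alpha=C_\alpha k_0^\alpha$, i.e. $\widetilde k_0^\alpha(z)=\frac{\alpha(z)-\alpha(0)}{z}$. Write $f\otimes g$ for the rank-one operator $h\mapsto\langle h,g\rangle f$, and for $c\in\mathbb C$ let $S_{\alpha,c}=S_\alpha+c\,(k_0^\alpha\otimes\widetilde k_0^\alpha)$ be the modified compressed shift on $K_\alpha$, where $S_\alpha f=P_\alpha(zf)$. For two finite Blaschke products $\alpha,\beta$ let $\mathscr T(\alpha,\beta)$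 be the set of all bounded linear operators $A\colon K_\alpha\to K_\beta$ for which there is $\varphi\in L^2(\partial\mathbb D)$ with $Af=P_\beta(\varphi f)$ for all bounded $f\in K_\alpha$. Let $\alpha,\beta$ be finite Blaschke products, let $a,b\in\mathbb C$, and let $A\colon K_\alpha\to K_\beta$ be a linear operator. Then: (i) $A\in\mathscr T(\alpha,\beta)$ if and only if there are $\chi\in K_\alpha$ and $\psi\in K_\beta$ such that $$A-S_{\beta,b}^{*}AS_{\alpha,a}=\psi\otimes\widetilde k_0^\alpha+\widetilde k_0^\beta\otimes\chi;$$ (ii) $A\in\mathscr T(\alpha,\beta)$ if and only if $C_\beta AC_\alpha\in\mathscr T(\alpha,\beta)$. -/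

import Mathlib

open MeasureTheory AddCircle
open scoped Real ComplexConjugate ENNReal

noncomputable section

/-- A finite Blaschke product
`z ↦ c * ∏ j, (z - a j) / (1 - conj (a j) * z)`, with `|c| = 1` and `|a j| < 1`. -/
structure FiniteBlaschkeProduct where
  /-- the number of zeros, with multiplicity -/
  degree : ℕ
  /-- the unimodular constant factor -/
  const : ℂ
  norm_const : ‖const‖ = 1
  /-- the zeros, repeated according to multiplicity -/
  zeros : Fin degree → ℂ
  norm_zeros_lt_one : ∀ j, ‖zeros j‖ < 1

namespace FiniteBlaschkeProduct

/-- The function defined by a finite Blaschke product. -/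
def toFun (α : FiniteBlaschkeProduct) (z : ℂ) : ℂ :=
  α.const * ∏ j, (z - α.zeros j) / (1 - conj (α.zeros j) * z)

instance : CoeFun FiniteBlaschkeProduct (fun _ => ℂ → ℂ) := ⟨toFun⟩

theorem denom_ne_zero {a z : ℂ} (ha : ‖a‖ < 1) (hz : ‖z‖ ≤ 1) : 1 - conj a * z ≠ 0 := by
  intro h
  have h1 : conj a * z = 1 := (sub_eq_zero.mp h).symm
  have h2 : ‖a‖ * ‖z‖ = 1 := by simpa using congrArg norm h1
  nlinarith [norm_nonneg a, norm_nonneg z]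

theorem differentiableAt (α : FiniteBlaschkeProduct) {z : ℂ} (hz : ‖z‖ ≤ 1) :
    DifferentiableAt ℂ α z := by
  unfold toFun
  refine DifferentiableAt.const_mul (DifferentiableAt.fun_finsetProd fun j _ => ?_) _
  refine DifferentiableAt.fun_div (by fun_prop) (by fun_prop) ?_
  exact denom_ne_zero (α.norm_zeros_lt_one j) hz

theorem norm_eq_one (α : FiniteBlaschkeProduct) {z : ℂ} (hz : ‖z‖ = 1) : ‖α z‖ = 1 := by
  unfold toFun
  rw [norm_mul, α.norm_const, norm_prod, one_mul]
  refine Finset.prod_eq_one fun j _ => ?_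
  have hne := denom_ne_zero (α.norm_zeros_lt_one j) hz.le
  rw [norm_div, div_eq_one_iff_eq (norm_ne_zero_iff.mpr hne)]
  have hz' : z * conj z = 1 := by rw [Complex.mul_conj, Complex.normSq_eq_norm_sq, hz]; simp
  have h1 : 1 - conj (α.zeros j) * z = z * conj (z - α.zeros j) := by
    rw [map_sub, mul_sub, hz']; ring
  rw [h1, norm_mul, hz, one_mul, Complex.norm_conj]

end FiniteBlaschkeProduct

instance fact_two_pi_pos : Fact (0 < 2 * π) := ⟨Real.two_pi_pos⟩

/-- The unit circle `∂𝔻`, parametrized by `t ↦ exp (i t)`, `t ∈ ℝ / 2πℤ`. It is used with the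
normalized Lebesgue measure `haarAddCircle`; `fourier n` is the function `zⁿ`. -/
abbrev UnitCirc := AddCircle (2 * π)

/-- `L²(∂𝔻)`. -/
abbrev L2Circ := Lp ℂ 2 (haarAddCircle : Measure UnitCirc)

/-- Multiplication by a continuous function on `L²(∂𝔻)`. -/
def mulOp (u : C(UnitCirc, ℂ)) : L2Circ →L[ℂ] L2Circ :=
  (ContinuousLinearMap.mul ℂ ℂ).holderL haarAddCircle ∞ 2 2
    (ContinuousMap.toLp ∞ haarAddCircle ℂ u)

theorem coeFn_mulOp (u : C(UnitCirc, ℂ)) (f : L2Circ) :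
    mulOp u f =ᵐ[haarAddCircle] fun t => u t * f t := by
  have h := (ContinuousLinearMap.mul ℂ ℂ).coeFn_holder (r := 2)
    (ContinuousMap.toLp ∞ haarAddCircle ℂ u) f
  filter_upwards [h, ContinuousMap.coeFn_toLp (p := ∞) (𝕜 := ℂ) haarAddCircle u] with t h1 h2
  rw [← h2]
  exact h1

theorem mulOp_mulOp (u v : C(UnitCirc, ℂ)) (f : L2Circ) :
    mulOp u (mulOp v f) = mulOp (u * v) f := by
  apply Lp.ext
  filter_upwards [coeFn_mulOp u (mulOp v f), coeFn_mulOp v f, coeFn_mulOp (u * v) f]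
    with t h1 h2 h3
  rw [h1, h2, h3, ContinuousMap.mul_apply, mul_assoc]

theorem mulOp_one (f : L2Circ) : mulOp 1 f = f := by
  apply Lp.ext
  filter_upwards [coeFn_mulOp 1 f] with t h1
  rw [h1, ContinuousMap.one_apply, one_mul]

theorem mulOp_toLp (u v : C(UnitCirc, ℂ)) :
    mulOp u (ContinuousMap.toLp 2 haarAddCircle ℂ v)
      = ContinuousMap.toLp 2 haarAddCircle ℂ (u * v) := by
  apply Lp.ext
  filter_upwards [coeFn_mulOp u (ContinuousMap.toLp 2 haarAddCircle ℂ v),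
    ContinuousMap.coeFn_toLp (p := 2) (𝕜 := ℂ) haarAddCircle v,
    ContinuousMap.coeFn_toLp (p := 2) (𝕜 := ℂ) haarAddCircle (u * v)] with t h1 h2 h3
  rw [h1, h2, h3, ContinuousMap.mul_apply]

theorem inner_mulOp_left (u : C(UnitCirc, ℂ)) (f g : L2Circ) :
    inner ℂ (mulOp u f) g = inner ℂ f (mulOp (star u) g) := by
  rw [L2.inner_def, L2.inner_def]
  apply integral_congr_ae
  filter_upwards [coeFn_mulOp u f, coeFn_mulOp (star u) g] with t h1 h2
  rw [h1, h2]
  simp only [RCLike.inner_apply', map_mul, ContinuousMap.star_apply, RCLike.star_def]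
  ring

theorem inner_mulOp_star (u : C(UnitCirc, ℂ)) (f g : L2Circ) :
    inner ℂ g (mulOp u (star f)) = inner ℂ f (mulOp u (star g)) := by
  rw [L2.inner_def, L2.inner_def]
  apply integral_congr_ae
  filter_upwards [coeFn_mulOp u (star f), coeFn_mulOp u (star g), Lp.coeFn_star f,
    Lp.coeFn_star g] with t h1 h2 h3 h4
  rw [h1, h2, h3, h4]
  simp only [RCLike.inner_apply', Pi.star_apply, RCLike.star_def]
  ring

theorem inner_fourierLp (n : ℤ) (f : L2Circ) :
    inner ℂ (fourierLp 2 n) f = fourierCoeff f n := by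
  rw [← fourierBasis_repr, fourierBasis.repr_apply_apply, coe_fourierBasis]

/-- The Hardy space `H²`, regarded as the closed subspace of `L²(∂𝔻)` of all functions whose
Fourier coefficients of negative index vanish. -/
def hardySpace : Submodule ℂ L2Circ where
  carrier := {f | ∀ n : ℤ, n < 0 → fourierCoeff f n = 0}
  zero_mem' n _ := by rw [← inner_fourierLp, inner_zero_right]
  add_mem' {f g} hf hg n hn := by
    rw [← inner_fourierLp, inner_add_right, inner_fourierLp, inner_fourierLp, hf n hn, hg n hn,
      add_zero]
  smul_mem' c f hf n hn := by
    rw [← inner_fourierLp, inner_smul_right, inner_fourierLp, hf n hn, mul_zero]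

theorem mem_hardySpace {f : L2Circ} :
    f ∈ hardySpace ↔ ∀ n : ℤ, n < 0 → fourierCoeff f n = 0 := Iff.rfl

theorem isClosed_hardySpace : IsClosed (hardySpace : Set L2Circ) := by
  have : (hardySpace : Set L2Circ)
      = ⋂ n : ℤ, ⋂ _ : n < 0, {f | inner ℂ (fourierLp 2 n) f = (0 : ℂ)} := by
    ext f
    simp [mem_hardySpace, inner_fourierLp]
  rw [this]
  exact isClosed_iInter fun n => isClosed_iInter fun _ =>
    isClosed_eq (by fun_prop) continuous_const

theorem fourierLp_mem_hardySpace {n : ℤ} (hn : 0 ≤ n) : fourierLp 2 n ∈ hardySpace := by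
  intro k hk
  rw [← inner_fourierLp]
  exact orthonormal_fourier.inner_eq_zero (by omega)

/-- An element of `H²` is orthogonal to every element of `L²(∂𝔻)` whose Fourier coefficients of
nonnegative index vanish. -/
theorem inner_eq_zero_of_mem_hardySpace {h g : L2Circ} (hh : h ∈ hardySpace)
    (hg : ∀ n : ℤ, 0 ≤ n → fourierCoeff g n = 0) : inner ℂ h g = (0 : ℂ) := by
  have key := fourierBasis.hasSum_inner_mul_inner h g
  rw [coe_fourierBasis] at key
  refine key.unique ?_
  convert! hasSum_zero (α := ℂ) (β := ℤ) using 1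
  funext n
  rw [inner_fourierLp]
  rcases lt_or_ge n 0 with hn | hn
  · rw [← inner_conj_symm, inner_fourierLp, hh n hn, map_zero, zero_mul]
  · rw [hg n hn, mul_zero]

namespace FiniteBlaschkeProduct

variable (α β : FiniteBlaschkeProduct)

/-- The restriction of a finite Blaschke product to the unit circle. -/
def boundary : C(UnitCirc, ℂ) where
  toFun t := α (toCircle t)
  continuous_toFun := by
    rw [continuous_iff_continuousAt]
    intro t
    have h1 : ContinuousAt α (toCircle t : ℂ) :=
      (α.differentiableAt (Circle.norm_coe _).le).continuousAt
    exact ContinuousAt.comp (f := fun t : UnitCirc => (toCircle t : ℂ)) h1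
      (continuous_subtype_val.comp continuous_toCircle).continuousAt

theorem boundary_apply (t : UnitCirc) : α.boundary t = α (toCircle t) := rfl

theorem star_boundary_mul : star α.boundary * α.boundary = 1 := by
  ext t
  have h : ‖α.boundary t‖ = 1 := by
    rw [boundary_apply]; exact α.norm_eq_one (Circle.norm_coe _)
  simp only [ContinuousMap.mul_apply, ContinuousMap.star_apply, RCLike.star_def,
    ContinuousMap.one_apply]
  rw [mul_comm, Complex.mul_conj, Complex.normSq_eq_norm_sq, h]; simp

theorem integral_boundary_mul_fourier (k : ℕ) :
    ∫ t, α.boundary t * fourier (k : ℤ) t ∂haarAddCircle = α 0 * 0 ^ k := by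
  have hd : DiffContOnCl ℂ (fun z => α z * z ^ k) (Metric.ball 0 |1|) := by
    refine DifferentiableOn.diffContOnCl fun z hz => ?_
    have hz' : ‖z‖ ≤ 1 := by
      have := Metric.closure_ball_subset_closedBall hz
      simpa using this
    exact ((α.differentiableAt hz').mul (by fun_prop)).differentiableWithinAt
  have h1 := hd.circleAverage
  rw [Real.circleAverage_def] at h1
  rw [integral_haarAddCircle, ← AddCircle.intervalIntegral_preimage (2 * π) 0, ← h1, zero_add]
  congr 1
  apply intervalIntegral.integral_congr
  intro θ _
  have : (toCircle (θ : UnitCirc) : ℂ) = circleMap 0 1 θ := by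
    rw [toCircle_apply_mk, Circle.coe_exp, circleMap]
    have : (2 * π / (2 * π) : ℝ) = 1 := div_self Real.two_pi_pos.ne'
    rw [this]; simp
  simp only [boundary_apply, fourier_apply, this, natCast_zsmul, toCircle_nsmul, Circle.coe_pow]

/-- The Fourier coefficients of nonpositive index of `α h`, for `h ∈ H²`. -/
theorem inner_fourierLp_mulOp {h : L2Circ} (hh : h ∈ hardySpace) (k : ℕ) :
    inner ℂ (fourierLp 2 (-(k : ℤ))) (mulOp α.boundary h)
      = α 0 * 0 ^ k * fourierCoeff h 0 := by
  have hs := hasSum_fourier_series_L2 h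
  have hs' := hs.mapL (innerSL ℂ (fourierLp 2 (-(k : ℤ))) ∘L mulOp α.boundary)
  simp only [map_smul, ContinuousLinearMap.comp_apply, innerSL_apply_apply] at hs'
  refine hs'.unique ?_
  have hval : ∀ i : ℕ, inner ℂ (fourierLp 2 (-(k : ℤ)) : L2Circ)
      (mulOp α.boundary (fourierLp 2 (i : ℤ))) = α 0 * 0 ^ (k + i) := by
    intro i
    rw [← α.integral_boundary_mul_fourier, L2.inner_def]
    apply integral_congr_ae
    filter_upwards [coeFn_mulOp α.boundary (fourierLp 2 (i : ℤ)), coeFn_fourierLp 2 (i : ℤ),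
      coeFn_fourierLp 2 (-(k : ℤ))] with t h1 h2 h3
    rw [h1, h2, h3, RCLike.inner_apply', ← fourier_neg, neg_neg, Nat.cast_add, fourier_add]
    ring
  have h0 := hval 0
  rw [add_zero, Nat.cast_zero] at h0
  rw [← h0, mul_comm (inner ℂ _ _)]
  refine hasSum_single (0 : ℤ) fun i hi => ?_
  rcases lt_or_ge i 0 with hneg | hpos
  · rw [hh i hneg, zero_smul]
  · obtain ⟨j, rfl⟩ := Int.eq_ofNat_of_zero_le hpos
    have hj : k + j ≠ 0 := by
      have : j ≠ 0 := by rintro rfl; exact hi rfl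
      omega
    rw [hval j, zero_pow hj, mul_zero, smul_zero]

theorem inner_mulOp_boundary (f g : L2Circ) :
    inner ℂ (mulOp α.boundary f) (mulOp α.boundary g) = inner ℂ f g := by
  rw [inner_mulOp_left, mulOp_mulOp, star_boundary_mul, mulOp_one]

/-- The model space `K_α = H² ⊖ α H²`. -/
def modelSpace : Submodule ℂ L2Circ :=
  hardySpace ⊓ (hardySpace.map (mulOp α.boundary).toLinearMap)ᗮ

theorem mem_modelSpace {f : L2Circ} : f ∈ α.modelSpace ↔
    f ∈ hardySpace ∧ ∀ h ∈ hardySpace, inner ℂ (mulOp α.boundary h) f = (0 : ℂ) := by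
  rw [modelSpace, Submodule.mem_inf, Submodule.mem_orthogonal]
  refine and_congr_right fun _ => ⟨fun H h hh => H _ ⟨h, hh, rfl⟩, ?_⟩
  rintro H _ ⟨h, hh, rfl⟩
  exact H h hh

instance : CompleteSpace α.modelSpace := by
  have : IsClosed (α.modelSpace : Set L2Circ) :=
    isClosed_hardySpace.inter (Submodule.isClosed_orthogonal _)
  exact this.completeSpace_coe

/-- The orthogonal projection `P_α` of `L²(∂𝔻)` onto `K_α`. -/
def proj : L2Circ →L[ℂ] α.modelSpace := α.modelSpace.orthogonalProjectionOnto

/-- The kernel function `k₀(z) = 1 - conj (α 0) * α z`, an element of `L²(∂𝔻)`. -/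
def kernelFun : L2Circ :=
  ContinuousMap.toLp 2 haarAddCircle ℂ (1 - conj (α 0) • α.boundary)

theorem kernelFun_eq : α.kernelFun
    = fourierLp 2 0 - conj (α 0) • mulOp α.boundary (fourierLp 2 0) := by
  have h1 : (fourier 0 : C(UnitCirc, ℂ)) = 1 := by ext t; simp
  rw [fourierLp, mulOp_toLp, h1, mul_one, ← map_smul, ← map_sub, kernelFun]

theorem kernelFun_mem : α.kernelFun ∈ α.modelSpace := by
  have h0 : (fourierLp 2 0 : L2Circ) ∈ hardySpace := fourierLp_mem_hardySpace le_rfl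
  rw [kernelFun_eq, mem_modelSpace]
  constructor
  · refine hardySpace.sub_mem h0 (hardySpace.smul_mem _ fun n hn => ?_)
    obtain ⟨k, hk⟩ := Int.exists_eq_neg_ofNat hn.le
    have hk0 : k ≠ 0 := by rintro rfl; simp at hk; omega
    rw [← inner_fourierLp, hk, α.inner_fourierLp_mulOp h0, zero_pow hk0, mul_zero, zero_mul]
  · intro h hh
    have h1 := α.inner_fourierLp_mulOp hh 0
    rw [Nat.cast_zero, neg_zero, pow_zero, mul_one] at h1
    rw [inner_sub_right, inner_smul_right, inner_mulOp_boundary,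
      ← inner_conj_symm, h1, ← inner_conj_symm h, inner_fourierLp, map_mul, sub_self]

/-- The kernel function `k₀` as an element of `K_α`. -/
def kernel : α.modelSpace := ⟨α.kernelFun, α.kernelFun_mem⟩

/-- The conjugation `C_α f (z) = α z * conj z * conj (f z)`, `|z| = 1`, on `L²(∂𝔻)`. -/
def conjL2 : L2Circ →ₛₗ[starRingEnd ℂ] L2Circ where
  toFun f := mulOp (α.boundary * fourier (-1)) (star f)
  map_add' f g := by
    rw [← map_add]
    congr 1
    apply Lp.ext
    filter_upwards [Lp.coeFn_star (f + g), Lp.coeFn_add f g, Lp.coeFn_add (star f) (star g),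
      Lp.coeFn_star f, Lp.coeFn_star g] with t h1 h2 h3 h4 h5
    rw [h1, h3, Pi.star_apply, h2, Pi.add_apply, Pi.add_apply, h4, h5, star_add]
    rfl
  map_smul' c f := by
    rw [← map_smul]
    congr 1
    apply Lp.ext
    filter_upwards [Lp.coeFn_star (c • f), Lp.coeFn_smul c f,
      Lp.coeFn_smul (starRingEnd ℂ c) (star f), Lp.coeFn_star f] with t h1 h2 h3 h4
    rw [h1, h3, Pi.star_apply, h2, Pi.smul_apply, Pi.smul_apply, h4, star_smul]
    rfl

theorem conjL2_apply (f : L2Circ) :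
    α.conjL2 f = mulOp (α.boundary * fourier (-1)) (star f) := rfl

theorem star_toLp (u : C(UnitCirc, ℂ)) :
    star (ContinuousMap.toLp 2 haarAddCircle ℂ u : L2Circ)
      = ContinuousMap.toLp 2 haarAddCircle ℂ (star u) := by
  apply Lp.ext
  filter_upwards [Lp.coeFn_star (ContinuousMap.toLp 2 haarAddCircle ℂ u),
    ContinuousMap.coeFn_toLp (p := 2) (𝕜 := ℂ) haarAddCircle u,
    ContinuousMap.coeFn_toLp (p := 2) (𝕜 := ℂ) haarAddCircle (star u)] with t h1 h2 h3
  rw [h1, h3, Pi.star_apply, h2, ContinuousMap.star_apply]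

theorem star_mulOp (u : C(UnitCirc, ℂ)) (f : L2Circ) :
    star (mulOp u f) = mulOp (star u) (star f) := by
  apply Lp.ext
  filter_upwards [Lp.coeFn_star (mulOp u f), coeFn_mulOp u f, coeFn_mulOp (star u) (star f),
    Lp.coeFn_star f] with t h1 h2 h3 h4
  rw [h1, h3, Pi.star_apply, h2, h4, ContinuousMap.star_apply, star_mul', Pi.star_apply]

theorem star_fourier (n : ℤ) : star (fourier n : C(UnitCirc, ℂ)) = fourier (-n) := by
  ext t
  rw [ContinuousMap.star_apply, fourier_neg, RCLike.star_def]

theorem fourier_mul_fourier (m n : ℤ) :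
    (fourier m * fourier n : C(UnitCirc, ℂ)) = fourier (m + n) := by
  ext t
  rw [ContinuousMap.mul_apply, fourier_add]

theorem conjL2_mem {f : L2Circ} (hf : f ∈ α.modelSpace) : α.conjL2 f ∈ α.modelSpace := by
  rw [mem_modelSpace] at hf ⊢
  obtain ⟨hf1, hf2⟩ := hf
  constructor
  · intro n hn
    rw [← inner_fourierLp, conjL2_apply, inner_mulOp_star, fourierLp, star_toLp, star_fourier,
      mulOp_toLp, mul_assoc, fourier_mul_fourier, ← mulOp_toLp, ← inner_conj_symm]
    have := hf2 (fourierLp 2 (-1 + -n)) (fourierLp_mem_hardySpace (by omega))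
    rw [fourierLp] at this
    rw [this, map_zero]
  · intro h hh
    have hu : α.boundary * fourier (-1) * star α.boundary = fourier (-1) := by
      rw [mul_right_comm, mul_comm α.boundary, star_boundary_mul, one_mul]
    rw [conjL2_apply, inner_mulOp_star, star_mulOp, mulOp_mulOp, hu]
    refine inner_eq_zero_of_mem_hardySpace hf1 fun n hn => ?_
    rw [← inner_fourierLp, inner_mulOp_star, fourierLp, star_toLp, star_fourier,
      mulOp_toLp, fourier_mul_fourier, ← inner_conj_symm]
    have := hh (-1 + -n) (by omega)
    rw [← inner_fourierLp, fourierLp] at this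
    rw [this, map_zero]

/-- The conjugation `C_α` on `K_α`. -/
def conjugation : α.modelSpace →ₛₗ[starRingEnd ℂ] α.modelSpace :=
  α.conjL2.restrict fun _ hf => α.conjL2_mem hf

/-- The conjugate kernel function `k̃₀ = C_α k₀`, that is, `k̃₀(z) = (α z - α 0) / z`. -/
def conjKernel : α.modelSpace := α.conjugation α.kernel

/-- The compressed shift `S_α f = P_α (z f)` on `K_α`. -/
def compressedShift : α.modelSpace →L[ℂ] α.modelSpace :=
  α.proj ∘L mulOp (fourier 1) ∘L α.modelSpace.subtypeL

/-- The modified compressed shift `S_{α,c} = S_α + c (k₀ ⊗ k̃₀)`; here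
`InnerProductSpace.rankOne ℂ f g` is the operator `f ⊗ g : h ↦ ⟨h, g⟩ f`. -/
def modifiedShift (c : ℂ) : α.modelSpace →L[ℂ] α.modelSpace :=
  α.compressedShift + c • InnerProductSpace.rankOne ℂ α.kernel α.conjKernel

/-- The product `φ f ∈ L²(∂𝔻)` of `φ ∈ L²(∂𝔻)` and a bounded `f ∈ L²(∂𝔻)`. -/
def mulBdd (φ f : L2Circ) (hf : MemLp f ∞ haarAddCircle) : L2Circ :=
  (hf.mul (r := 2) (Lp.memLp φ)).toLp (φ * f)

/-- `𝒯(α, β)`: the bounded linear operators `A : K_α → K_β` that are given on the bounded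
functions in `K_α` by `A f = P_β (φ f)`, for some `φ ∈ L²(∂𝔻)`. -/
def truncatedToeplitz : Set (α.modelSpace →ₗ[ℂ] β.modelSpace) :=
  {A | Continuous A ∧ ∃ φ : L2Circ, ∀ (f : α.modelSpace)
    (hf : MemLp (f : L2Circ) ∞ haarAddCircle), A f = β.proj (mulBdd φ f hf)}

end FiniteBlaschkeProduct

end

noncomputable section


/-! Write `D(A) = A - S_β* A S_α`. Multiplying `f ∈ K_α` by the denominator of `α` gives a
polynomial of degree below that of `α`. Hence `K_α` is finite-dimensional and consists of continuous
functions, so `A ∈ 𝒯(α, β)` means only that `⟨A f, g⟩` is the pairing of one fixed `φ` with `g`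
times the conjugate of `f` (`mem_truncatedToeplitz_iff`).

On the circle `S_α f = z f - ⟨f, k̃₀⟩ α` (`compressedShift_coe`). In `⟨A S_α f, S_β g⟩` the factors
`z` and `z̄` cancel, so `D(A)` retains only terms containing `⟨f, k̃₀⟩` or `⟨k̃₀, g⟩`, which is the
required form (`displacement_of_symbol`). Conversely, an explicit symbol built from `χ` and `ψ`
realizes any prescribed right-hand side, and `D` is injective because the powers of the compressed
shift tend to zero (`eq_zero_of_inner_compressedShift`). So `A` is the operator with that symbol.
Passing from `S_α`, `S_β` to the modified shifts alters only `χ` and `ψ`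
(`exists_rankOne_displacement_iff`).

For (ii), conjugating by `C_α` and `C_β` turns the symbol `φ` into `β ᾱ φ̄`, and both conjugations
are involutions. -/

/-! ### Multiplication operators and the Hardy space -/

theorem mulOp_sub_left (u v : C(UnitCirc, ℂ)) (f : L2Circ) :
    mulOp (u - v) f = mulOp u f - mulOp v f := by
  simp [mulOp]

theorem mulOp_smul_left (c : ℂ) (u : C(UnitCirc, ℂ)) (f : L2Circ) :
    mulOp (c • u) f = c • mulOp u f := by
  simp [mulOp]

theorem inner_mulOp_right (u : C(UnitCirc, ℂ)) (f g : L2Circ) :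
    inner ℂ f (mulOp u g) = inner ℂ (mulOp (star u) f) g := by
  rw [inner_mulOp_left, star_star]

/-- A continuous function on the circle, as an element of `L²(∂𝔻)`. -/
abbrev contL2 (u : C(UnitCirc, ℂ)) : L2Circ := ContinuousMap.toLp 2 haarAddCircle ℂ u

/-- This makes the form of a truncated Toeplitz operator depend on its two arguments only through
one product of continuous functions. -/
theorem inner_contL2_mulOp (u v : C(UnitCirc, ℂ)) (φ : L2Circ) :
    inner ℂ (contL2 v) (mulOp u φ) = inner ℂ (contL2 (v * star u)) φ := by
  rw [inner_mulOp_right, mulOp_toLp, mul_comm (star u)]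

theorem norm_mulOp_fourier (n : ℤ) (f : L2Circ) : ‖mulOp (fourier n) f‖ = ‖f‖ := by
  have h : inner ℂ (mulOp (fourier n) f) (mulOp (fourier n) f) = inner ℂ f f := by
    rw [inner_mulOp_left, mulOp_mulOp, FiniteBlaschkeProduct.star_fourier,
      FiniteBlaschkeProduct.fourier_mul_fourier, neg_add_cancel]
    have h1 : (fourier 0 : C(UnitCirc, ℂ)) = 1 := by ext t; simp
    rw [h1, mulOp_one]
  rw [inner_self_eq_norm_sq_to_K, inner_self_eq_norm_sq_to_K] at h
  have h2 : ‖mulOp (fourier n) f‖ ^ 2 = ‖f‖ ^ 2 := by exact_mod_cast h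
  exact (pow_left_inj₀ (norm_nonneg _) (norm_nonneg _) two_ne_zero).mp h2

theorem inner_fourierLp_mulOp_fourier (n m : ℤ) (f : L2Circ) :
    inner ℂ (fourierLp 2 n) (mulOp (fourier m) f) = fourierCoeff f (n - m) := by
  rw [fourierLp, inner_contL2_mulOp, FiniteBlaschkeProduct.star_fourier,
    FiniteBlaschkeProduct.fourier_mul_fourier, ← sub_eq_add_neg, ← inner_fourierLp, fourierLp]

theorem mulOp_fourier_mem_hardySpace {f : L2Circ} (hf : f ∈ hardySpace) {m : ℤ} (hm : 0 ≤ m) :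
    mulOp (fourier m) f ∈ hardySpace := by
  intro n hn
  rw [← inner_fourierLp, inner_fourierLp_mulOp_fourier]
  exact hf _ (by omega)

/-- The pairing of an element of `H²` with an element of `L²(∂𝔻)` whose Fourier coefficients of
positive index vanish. -/
theorem inner_of_mem_hardySpace {h g : L2Circ} (hh : h ∈ hardySpace)
    (hg : ∀ n : ℤ, 0 < n → fourierCoeff g n = 0) :
    inner ℂ h g = fourierCoeff g 0 * inner ℂ h (fourierLp 2 0) := by
  have key : inner ℂ h (g - fourierCoeff g 0 • fourierLp 2 0) = (0 : ℂ) := by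
    refine inner_eq_zero_of_mem_hardySpace hh fun n hn => ?_
    rw [← inner_fourierLp, inner_sub_right, inner_smul_right, inner_fourierLp]
    rcases hn.eq_or_lt with rfl | hn'
    · have : inner ℂ (fourierLp 2 0 : L2Circ) (fourierLp 2 0) = (1 : ℂ) := by
        rw [inner_self_eq_norm_sq_to_K, orthonormal_fourier.norm_eq_one]; simp
      rw [this, mul_one, sub_self]
    · rw [hg n hn', orthonormal_fourier.inner_eq_zero (by omega), mul_zero, sub_zero]
  rw [inner_sub_right, inner_smul_right, sub_eq_zero] at key
  exact key

/-- For `f ∈ H²` the functions `zⁿ f` tend weakly to `0`. -/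
theorem tendsto_inner_mulOp_fourier {f : L2Circ} (hf : f ∈ hardySpace) (g : L2Circ) :
    Filter.Tendsto (fun n : ℕ => inner ℂ g (mulOp (fourier (n : ℤ)) f)) Filter.atTop
      (nhds (0 : ℂ)) := by
  rw [Metric.tendsto_atTop]
  intro ε hε
  -- The `+ 1` covers `f = 0` and makes the final estimate strict.
  have hpos : 0 < ε / (‖f‖ + 1) := by positivity
  obtain ⟨s, hs⟩ := ((Metric.tendsto_nhds.mp (hasSum_fourier_series_L2 g)) _ hpos).exists
  obtain ⟨N, hN⟩ : ∃ N : ℕ, ∀ k ∈ s, k < N := by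
    refine ⟨(∑ k ∈ s, k.natAbs) + 1, fun k hk => ?_⟩
    have := Finset.single_le_sum (f := fun k : ℤ => k.natAbs) (fun _ _ => Nat.zero_le _) hk
    omega
  refine ⟨N, fun n hn => ?_⟩
  set p := ∑ k ∈ s, fourierCoeff g k • (fourierLp 2 k : L2Circ) with hp
  -- All frequencies of `p` lie below `N ≤ n`, while those of `zⁿ f` are at least `n`.
  have h0 : inner ℂ p (mulOp (fourier (n : ℤ)) f) = (0 : ℂ) := by
    rw [hp, sum_inner]
    refine Finset.sum_eq_zero fun k hk => ?_
    rw [inner_smul_left, inner_fourierLp_mulOp_fourier, hf _ (by have := hN k hk; omega), mul_zero]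
  have h1 : inner ℂ g (mulOp (fourier (n : ℤ)) f) = inner ℂ (g - p) (mulOp (fourier (n : ℤ)) f) := by
    rw [inner_sub_left, h0, sub_zero]
  rw [dist_zero_right, h1]
  calc ‖inner ℂ (g - p) (mulOp (fourier (n : ℤ)) f)‖ ≤ ‖g - p‖ * ‖f‖ := by
        rw [← norm_mulOp_fourier n f]; exact norm_inner_le_norm _ _
    _ ≤ ε / (‖f‖ + 1) * ‖f‖ := by
        gcongr
        rw [← dist_eq_norm, dist_comm]
        exact hs.le
    _ < ε := by
        rw [div_mul_eq_mul_div, div_lt_iff₀ (by positivity)]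
        nlinarith [norm_nonneg f]

namespace FiniteBlaschkeProduct

variable (α β : FiniteBlaschkeProduct)

theorem fourier_zero_eq_one : (fourier 0 : C(UnitCirc, ℂ)) = 1 := by ext t; simp

theorem mulOp_boundary_mem_hardySpace {h : L2Circ} (hh : h ∈ hardySpace) :
    mulOp α.boundary h ∈ hardySpace := by
  intro n hn
  obtain ⟨k, hk⟩ := Int.exists_eq_neg_ofNat hn.le
  have hk0 : k ≠ 0 := by rintro rfl; simp at hk; omega
  rw [← inner_fourierLp, hk, α.inner_fourierLp_mulOp hh, zero_pow hk0, mul_zero, zero_mul]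

theorem contL2_boundary : contL2 α.boundary = mulOp α.boundary (fourierLp 2 0) := by
  rw [fourierLp, mulOp_toLp, fourier_zero_eq_one, mul_one]

/-! ### Elements of the model space are continuous -/

/-- The denominator `∏ j, (1 - conj (a j) * z)` on the unit circle. -/
def denom : C(UnitCirc, ℂ) := ∏ j, (1 - conj (α.zeros j) • fourier 1)

/-- The numerator `∏ j, (z - a j)` on the unit circle. -/
def numer : C(UnitCirc, ℂ) := ∏ j, (fourier 1 - α.zeros j • 1)

theorem denom_apply (t : UnitCirc) :
    α.denom t = ∏ j, (1 - conj (α.zeros j) * (toCircle t : ℂ)) := by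
  simp [denom, ContinuousMap.prod_apply]

theorem denom_apply_ne_zero (t : UnitCirc) : α.denom t ≠ 0 := by
  rw [denom_apply]
  exact Finset.prod_ne_zero_iff.mpr fun j _ =>
    denom_ne_zero (α.norm_zeros_lt_one j) (Circle.norm_coe _).le

theorem boundary_mul_denom : α.boundary * α.denom = α.const • α.numer := by
  ext t
  have h : ∀ j, (1 - conj (α.zeros j) * (toCircle t : ℂ)) ≠ 0 := fun j =>
    denom_ne_zero (α.norm_zeros_lt_one j) (Circle.norm_coe _).le
  rw [ContinuousMap.mul_apply, denom_apply, boundary_apply, toFun, mul_assoc,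
    ← Finset.prod_mul_distrib]
  simp [numer, div_mul_cancel₀ _ (h _)]

/-- Factor by factor, `z` times the conjugate of `1 - ā z` is `z - a`, because `z z̄ = 1`. -/
theorem star_denom_mul_fourier : star α.denom * fourier (α.degree : ℤ) = α.numer := by
  ext t
  have hz : (toCircle t : ℂ) * conj (toCircle t : ℂ) = 1 := by
    rw [Complex.mul_conj, Complex.normSq_eq_norm_sq, Circle.norm_coe]; simp
  have h2 : (fourier (α.degree : ℤ) t : ℂ) = ∏ _j : Fin α.degree, (toCircle t : ℂ) := by
    simp [fourier_apply, toCircle_nsmul]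
  rw [ContinuousMap.mul_apply, ContinuousMap.star_apply, denom_apply, h2, RCLike.star_def, map_prod,
    ← Finset.prod_mul_distrib, numer, ContinuousMap.prod_apply]
  refine Finset.prod_congr rfl fun j _ => ?_
  simp only [map_sub, map_one, map_mul, Complex.conj_conj, ContinuousMap.sub_apply,
    fourier_apply, one_smul, ContinuousMap.smul_apply, ContinuousMap.one_apply, smul_eq_mul]
  linear_combination (-α.zeros j) * hz

theorem mulOp_denom_mem_hardySpace {f : L2Circ} (hf : f ∈ hardySpace) :
    mulOp α.denom f ∈ hardySpace := by
  rw [denom]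
  refine Finset.prod_induction _ (fun u => ∀ f ∈ hardySpace, mulOp u f ∈ hardySpace)
    ?_ ?_ ?_ f hf
  · intro u v hu hv f hf
    rw [← mulOp_mulOp]
    exact hu _ (hv _ hf)
  · intro f hf
    rwa [mulOp_one]
  · intro j _ f hf
    rw [mulOp_sub_left, mulOp_one, mulOp_smul_left]
    exact hardySpace.sub_mem hf (hardySpace.smul_mem _ (mulOp_fourier_mem_hardySpace hf zero_le_one))

/-- For `n` at least the degree `m`, `zⁿ` times the conjugate denominator is a constant times `α ·
denom · zⁿ⁻ᵐ`, an element of `α H²`, hence orthogonal to `f`. The case `n = m` is included, so only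
the frequencies `0, …, m - 1` survive. -/
theorem fourierCoeff_mulOp_denom {f : L2Circ} (hf : f ∈ α.modelSpace) {n : ℤ}
    (hn : (α.degree : ℤ) ≤ n) : fourierCoeff (mulOp α.denom f) n = 0 := by
  have hc : α.const ≠ 0 := by
    intro h; have := α.norm_const; rw [h] at this; simp at this
  have h1 : fourier n * star α.denom
      = α.const⁻¹ • (α.boundary * (α.denom * fourier (n - α.degree))) := by
    have : (fourier n : C(UnitCirc, ℂ)) = fourier (α.degree : ℤ) * fourier (n - α.degree) := by
      rw [fourier_mul_fourier, add_sub_cancel]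
    rw [← mul_assoc, boundary_mul_denom, this, mul_comm _ (star α.denom), ← mul_assoc,
      star_denom_mul_fourier,
      smul_mul_assoc, smul_smul, inv_mul_cancel₀ hc, one_smul]
  rw [← inner_fourierLp, fourierLp, inner_contL2_mulOp, h1, contL2, map_smul, inner_smul_left,
    ← mulOp_toLp, (α.mem_modelSpace.mp hf).2, mul_zero]
  rw [← mulOp_toLp]
  exact α.mulOp_denom_mem_hardySpace (fourierLp_mem_hardySpace (by omega))

/-- The reciprocal of the denominator on the unit circle. -/
def invDenom : C(UnitCirc, ℂ) where
  toFun t := (α.denom t)⁻¹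
  continuous_toFun := α.denom.continuous.inv₀ α.denom_apply_ne_zero

theorem invDenom_mul_denom : α.invDenom * α.denom = 1 := by
  ext t
  exact inv_mul_cancel₀ (α.denom_apply_ne_zero t)

theorem eq_sum_of_mem_modelSpace {f : L2Circ} (hf : f ∈ α.modelSpace) :
    f = ∑ n ∈ Finset.Ico (0 : ℤ) α.degree,
      fourierCoeff (mulOp α.denom f) n • contL2 (α.invDenom * fourier n) := by
  have h1 : mulOp α.denom f = ∑ n ∈ Finset.Ico (0 : ℤ) α.degree,
      fourierCoeff (mulOp α.denom f) n • fourierLp 2 n := by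
    refine (hasSum_fourier_series_L2 (mulOp α.denom f)).unique
      (hasSum_sum_of_ne_finset_zero fun n hn => ?_)
    rw [Finset.mem_Ico, not_and_or, not_le, not_lt] at hn
    rcases hn with hn | hn
    · rw [α.mulOp_denom_mem_hardySpace (α.mem_modelSpace.mp hf).1 n hn, zero_smul]
    · rw [α.fourierCoeff_mulOp_denom hf hn, zero_smul]
  have h2 : f = mulOp α.invDenom (mulOp α.denom f) := by
    rw [mulOp_mulOp, invDenom_mul_denom, mulOp_one]
  conv_lhs => rw [h2, h1, map_sum]
  simp only [map_smul, fourierLp, mulOp_toLp]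

/-- Consequently every element of `K_α` is bounded, and the restriction to bounded functions in the
definition of `𝒯(α, β)` excludes nothing. -/
theorem exists_eq_contL2 {f : L2Circ} (hf : f ∈ α.modelSpace) :
    ∃ u : C(UnitCirc, ℂ), f = contL2 u := by
  refine ⟨∑ n ∈ Finset.Ico (0 : ℤ) α.degree,
      fourierCoeff (mulOp α.denom f) n • (α.invDenom * fourier n), ?_⟩
  conv_lhs => rw [α.eq_sum_of_mem_modelSpace hf]
  simp only [contL2, map_sum, map_smul]

instance finiteDimensional_modelSpace : FiniteDimensional ℂ α.modelSpace := by
  classical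
  have hle : α.modelSpace ≤ Submodule.span ℂ
      (((Finset.Ico (0 : ℤ) α.degree).image fun n => contL2 (α.invDenom * fourier n) :
        Finset L2Circ) : Set L2Circ) := by
    intro f hf
    rw [α.eq_sum_of_mem_modelSpace hf]
    refine Submodule.sum_mem _ fun n hn => Submodule.smul_mem _ _ (Submodule.subset_span ?_)
    exact Finset.mem_coe.mpr (Finset.mem_image_of_mem _ hn)
  exact Submodule.finiteDimensional_of_le hle

theorem boundary_mul_star : α.boundary * star α.boundary = 1 := by
  rw [mul_comm α.boundary, star_boundary_mul]

theorem inner_proj (g : α.modelSpace) (x : L2Circ) :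
    inner ℂ g (α.proj x) = inner ℂ (g : L2Circ) x :=
  Submodule.inner_orthogonalProjectionOnto_eq_of_mem_left g x

theorem proj_inner (g : α.modelSpace) (x : L2Circ) :
    inner ℂ (α.proj x) g = inner ℂ x (g : L2Circ) :=
  Submodule.inner_orthogonalProjectionOnto_eq_of_mem_right g x

/-! ### The conjugation -/

theorem conjugation_coe (f : α.modelSpace) : (α.conjugation f : L2Circ) = α.conjL2 f := rfl

theorem boundary_mul_fourier_mul_star :
    (α.boundary * fourier (-1)) * star (α.boundary * fourier (-1)) = 1 := by
  rw [star_mul', star_fourier, neg_neg, mul_mul_mul_comm, boundary_mul_star, one_mul,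
    fourier_mul_fourier, neg_add_cancel, fourier_zero_eq_one]

theorem conjL2_conjL2 (f : L2Circ) : α.conjL2 (α.conjL2 f) = f := by
  rw [conjL2_apply, conjL2_apply, star_mulOp, star_star, mulOp_mulOp,
    boundary_mul_fourier_mul_star, mulOp_one]

theorem conjugation_conjugation (f : α.modelSpace) : α.conjugation (α.conjugation f) = f :=
  Subtype.ext (α.conjL2_conjL2 f)

theorem inner_conjL2 (f g : L2Circ) : inner ℂ g (α.conjL2 f) = inner ℂ f (α.conjL2 g) :=
  inner_mulOp_star _ _ _

theorem conjL2_inner (f g : L2Circ) : inner ℂ (α.conjL2 f) g = inner ℂ (α.conjL2 g) f := by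
  rw [← inner_conj_symm, inner_conjL2, inner_conj_symm]

theorem conjL2_contL2 (u : C(UnitCirc, ℂ)) :
    α.conjL2 (contL2 u) = contL2 (α.boundary * fourier (-1) * star u) := by
  rw [conjL2_apply, star_toLp, mulOp_toLp]

/-! ### The compressed shift -/

/-- On the circle `k̃₀ = α z̄ - α(0) z̄`, and `z̄` is orthogonal to `H²`. -/
theorem inner_conjKernel {f : L2Circ} (hf : f ∈ hardySpace) :
    inner ℂ (α.conjKernel : L2Circ) f = inner ℂ (contL2 α.boundary) (mulOp (fourier 1) f) := by
  have h1 : (α.conjKernel : L2Circ)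
      = contL2 (α.boundary * fourier (-1)) - α 0 • fourierLp 2 (-1) := by
    change α.conjL2 (contL2 _) = _
    rw [conjL2_contL2, fourierLp, ← map_smul, ← map_sub]
    congr 1
    rw [star_sub, star_one, star_smul, RCLike.star_def, Complex.conj_conj, mul_sub, mul_one,
      mul_smul_comm, mul_right_comm, boundary_mul_star, one_mul]
  rw [h1, inner_sub_left, inner_smul_left, inner_fourierLp, hf (-1) (by norm_num), mul_zero,
    sub_zero, inner_contL2_mulOp, star_fourier]

/-- The function `ᾱ z f` is the complex conjugate of `C_α f ∈ H²`, so it has no positive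
frequencies. Pairing it with `h ∈ H²` therefore sees only its constant term, which is `⟨f, k̃₀⟩`. -/
theorem inner_mulOp_boundary_mulOp_fourier {h f : L2Circ} (hh : h ∈ hardySpace) (hf : f ∈ α.modelSpace) :
    inner ℂ (mulOp α.boundary h) (mulOp (fourier 1) f)
      = inner ℂ (α.conjKernel : L2Circ) f * inner ℂ h (fourierLp 2 0) := by
  have hg : ∀ n : ℤ, inner ℂ (fourierLp 2 n) (mulOp (star α.boundary) (mulOp (fourier 1) f))
      = conj (fourierCoeff (α.conjL2 f) (-n)) := by
    intro n
    rw [← inner_fourierLp, inner_conj_symm, fourierLp, fourierLp, conjL2_inner, conjL2_contL2,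
      mulOp_mulOp, inner_contL2_mulOp, star_mul', star_star, star_fourier, star_fourier, neg_neg,
      mul_comm (fourier n)]
  rw [inner_mulOp_left, inner_of_mem_hardySpace hh, α.inner_conjKernel (α.mem_modelSpace.mp hf).1,
    contL2_boundary, inner_mulOp_left, inner_fourierLp]
  intro n hn
  rw [← inner_fourierLp, hg, (α.mem_modelSpace.mp (α.conjL2_mem hf)).1 _ (by omega), map_zero]

/-- `S_α f = z f - ⟨f, k̃₀⟩ α`. -/
theorem compressedShift_coe (f : α.modelSpace) : (α.compressedShift f : L2Circ)
    = mulOp (fourier 1) f - inner ℂ α.conjKernel f • contL2 α.boundary := by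
  have hf := (α.mem_modelSpace.mp f.2).1
  have h0 : (fourierLp 2 0 : L2Circ) ∈ hardySpace := fourierLp_mem_hardySpace le_rfl
  -- The subtracted multiple of `α` is orthogonal to `K_α`; once the difference lies in `K_α`, it
  -- must be the projection of `z f`.
  have hmem : mulOp (fourier 1) f - inner ℂ α.conjKernel f • contL2 α.boundary
      ∈ α.modelSpace := by
    rw [mem_modelSpace, contL2_boundary]
    refine ⟨hardySpace.sub_mem (mulOp_fourier_mem_hardySpace hf zero_le_one)
      (hardySpace.smul_mem _ (α.mulOp_boundary_mem_hardySpace h0)), fun h hh => ?_⟩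
    rw [inner_sub_right, inner_smul_right, α.inner_mulOp_boundary_mulOp_fourier hh f.2,
      inner_mulOp_boundary, Submodule.coe_inner, sub_self]
  suffices α.compressedShift f = ⟨_, hmem⟩ from congrArg Subtype.val this
  refine ext_inner_left ℂ fun g => ?_
  change inner ℂ g (α.proj (mulOp (fourier 1) f)) = _
  have hg : inner ℂ (g : L2Circ) (contL2 α.boundary) = 0 := by
    rw [← inner_conj_symm, contL2_boundary, (α.mem_modelSpace.mp g.2).2 _ h0, map_zero]
  rw [inner_proj, Submodule.coe_inner, inner_sub_right, inner_smul_right, hg, mul_zero, sub_zero]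

/-! ### Decay of the powers of the shift and the Stein equation -/

/-- The error lies in `α H²` and is invisible to `K_α`, so `S_αⁿ f` inherits the weak convergence of
`zⁿ f` to zero. -/
theorem exists_compressedShift_pow (f : α.modelSpace) (n : ℕ) :
    ∃ h ∈ hardySpace, ((α.compressedShift ^ n) f : L2Circ)
      = mulOp (fourier (n : ℤ)) f + mulOp α.boundary h := by
  induction n with
  | zero =>
    refine ⟨0, hardySpace.zero_mem, ?_⟩
    simp only [Nat.cast_zero, fourier_zero_eq_one, mulOp_one, map_zero, add_zero, pow_zero]
    rfl
  | succ n ih =>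
    obtain ⟨h, hh, hn⟩ := ih
    refine ⟨mulOp (fourier 1) h - inner ℂ α.conjKernel ((α.compressedShift ^ n) f) • fourierLp 2 0,
      hardySpace.sub_mem (mulOp_fourier_mem_hardySpace hh zero_le_one)
        (hardySpace.smul_mem _ (fourierLp_mem_hardySpace le_rfl)), ?_⟩
    have hF : (α.compressedShift ^ (n + 1)) f = α.compressedShift ((α.compressedShift ^ n) f) := by
      rw [pow_succ']; rfl
    have hcast : (1 : ℤ) + n = (n + 1 : ℕ) := by push_cast; ring
    rw [hF, compressedShift_coe]
    generalize (α.compressedShift ^ n) f = F at hn ⊢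
    rw [hn, map_add, mulOp_mulOp, mulOp_mulOp, fourier_mul_fourier, hcast, map_sub, map_smul,
      ← contL2_boundary, mulOp_mulOp, mul_comm α.boundary (fourier 1), add_sub_assoc]

theorem tendsto_compressedShift_pow (f : α.modelSpace) :
    Filter.Tendsto (fun n : ℕ => (α.compressedShift ^ n) f) Filter.atTop (nhds 0) := by
  have key : ∀ g : α.modelSpace, Filter.Tendsto
      (fun n : ℕ => inner ℂ g ((α.compressedShift ^ n) f)) Filter.atTop (nhds (0 : ℂ)) := by
    intro g
    refine (tendsto_inner_mulOp_fourier (α.mem_modelSpace.mp f.2).1 (g : L2Circ)).congr fun n => ?_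
    obtain ⟨h, hh, hn⟩ := α.exists_compressedShift_pow f n
    rw [Submodule.coe_inner, hn, inner_add_right, ← inner_conj_symm (g : L2Circ) (mulOp _ h),
      (α.mem_modelSpace.mp g.2).2 _ hh, map_zero, add_zero]
  -- In finite dimension, convergence of the coordinates upgrades weak to norm convergence.
  let e := stdOrthonormalBasis ℂ α.modelSpace
  have hsum : Filter.Tendsto
      (fun n : ℕ => ∑ i, inner ℂ (e i) ((α.compressedShift ^ n) f) • e i) Filter.atTop
      (nhds (∑ i, (0 : ℂ) • e i)) :=
    tendsto_finsetSum _ fun i _ => (key (e i)).smul_const _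
  simpa only [e.sum_repr', zero_smul, Finset.sum_const_zero] using hsum

/-- The Stein equation `D = S_β* D S_α` has only the trivial solution. -/
theorem eq_zero_of_inner_compressedShift {D : α.modelSpace →ₗ[ℂ] β.modelSpace}
    (hD : ∀ f g, inner ℂ g (D f) = inner ℂ (β.compressedShift g) (D (α.compressedShift f))) :
    D = 0 := by
  have hpow : ∀ (n : ℕ) f g, inner ℂ g (D f)
      = inner ℂ ((β.compressedShift ^ n) g) (D ((α.compressedShift ^ n) f)) := by
    intro n
    induction n with
    | zero => intro f g; rfl
    | succ n ih =>
      intro f g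
      rw [ih, hD, pow_succ', pow_succ']
      rfl
  have hcont : Continuous D := D.continuous_of_finiteDimensional
  ext1 f
  refine ext_inner_left ℂ fun g => ?_
  have hlim : Filter.Tendsto (fun n : ℕ =>
      inner ℂ ((β.compressedShift ^ n) g) (D ((α.compressedShift ^ n) f))) Filter.atTop
      (nhds (inner ℂ 0 (D 0))) :=
    (β.tendsto_compressedShift_pow g).inner
      ((hcont.tendsto 0).comp (α.tendsto_compressedShift_pow f))
  rw [inner_zero_left] at hlim
  rw [LinearMap.zero_apply, inner_zero_right]
  exact tendsto_nhds_unique (tendsto_const_nhds.congr fun n => hpow n f g) hlim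

/-! ### Truncated Toeplitz operators -/

theorem modelSpace_inner_conj_symm (f g : α.modelSpace) : conj (inner ℂ f g) = inner ℂ g f :=
  inner_conj_symm (g : L2Circ) (f : L2Circ)

theorem modelSpace_inner_smul_right (f g : α.modelSpace) (c : ℂ) :
    inner ℂ f (c • g) = c * inner ℂ f g :=
  inner_smul_right (f : L2Circ) (g : L2Circ) c

theorem mulBdd_eq_mulOp (φ : L2Circ) {f : L2Circ} {u : C(UnitCirc, ℂ)} (hu : f = contL2 u)
    (hf : MemLp f ∞ haarAddCircle) : mulBdd φ f hf = mulOp u φ := by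
  subst hu
  apply Lp.ext
  filter_upwards [(hf.mul (r := 2) (Lp.memLp φ)).coeFn_toLp, coeFn_mulOp u φ,
    ContinuousMap.coeFn_toLp (p := 2) (𝕜 := ℂ) haarAddCircle u] with t h1 h2 h3
  rw [mulBdd, h1, h2, Pi.mul_apply, h3, mul_comm]

theorem memLp_top_contL2 (u : C(UnitCirc, ℂ)) : MemLp (contL2 u) ∞ haarAddCircle := by
  refine MemLp.ae_eq ?_ (Lp.memLp (ContinuousMap.toLp ∞ haarAddCircle ℂ u))
  exact (ContinuousMap.coeFn_toLp (p := ∞) (𝕜 := ℂ) haarAddCircle u).trans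
    (ContinuousMap.coeFn_toLp (p := 2) (𝕜 := ℂ) haarAddCircle u).symm

variable {α β}

/-- Continuity of `A` and boundedness of `f` are automatic here, so membership reduces to a
condition on the sesquilinear form alone. -/
theorem mem_truncatedToeplitz_iff {A : α.modelSpace →ₗ[ℂ] β.modelSpace} :
    A ∈ α.truncatedToeplitz β ↔ ∃ φ : L2Circ, ∀ (u v : C(UnitCirc, ℂ)) (f : α.modelSpace)
      (g : β.modelSpace), (f : L2Circ) = contL2 u → (g : L2Circ) = contL2 v →
      inner ℂ g (A f) = inner ℂ (contL2 (v * star u)) φ := by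
  constructor
  · rintro ⟨-, φ, h⟩
    refine ⟨φ, fun u v f g hu hv => ?_⟩
    have hb : MemLp (f : L2Circ) ∞ haarAddCircle := by rw [hu]; exact memLp_top_contL2 u
    rw [h f hb, inner_proj, mulBdd_eq_mulOp φ hu, hv, inner_contL2_mulOp]
  · rintro ⟨φ, h⟩
    refine ⟨A.continuous_of_finiteDimensional, φ, fun f hb => ext_inner_left ℂ fun g => ?_⟩
    obtain ⟨u, hu⟩ := α.exists_eq_contL2 f.2
    obtain ⟨v, hv⟩ := β.exists_eq_contL2 g.2
    rw [h u v f g hu hv, inner_proj, mulBdd_eq_mulOp φ hu, hv, inner_contL2_mulOp]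

theorem conjugation_comp_mem_truncatedToeplitz {A : α.modelSpace →ₗ[ℂ] β.modelSpace}
    (hA : A ∈ α.truncatedToeplitz β) :
    β.conjugation.comp (A.comp α.conjugation) ∈ α.truncatedToeplitz β := by
  rw [mem_truncatedToeplitz_iff] at hA ⊢
  obtain ⟨φ, h⟩ := hA
  -- In the product of `C_β g` with the conjugate of `C_α f` the factors `z̄` and `z` cancel,
  -- leaving `β ᾱ` times the conjugate of `g f̄`; this dictates the new symbol.
  refine ⟨mulOp (β.boundary * star α.boundary) (star φ), fun u v f g hf hg => ?_⟩
  have h1 := h _ _ (α.conjugation f) (β.conjugation g)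
    ((congrArg α.conjL2 hf).trans (α.conjL2_contL2 u))
    ((congrArg β.conjL2 hg).trans (β.conjL2_contL2 v))
  have h2 : inner ℂ g (β.conjugation (A (α.conjugation f)))
      = inner ℂ (A (α.conjugation f)) (β.conjugation g) := by
    rw [Submodule.coe_inner, Submodule.coe_inner, conjugation_coe, inner_conjL2, conjugation_coe]
  have h3 : β.boundary * fourier (-1) * star v * star (α.boundary * fourier (-1) * star u)
      = β.boundary * star α.boundary * star (v * star u) := by
    have h4 : (fourier (-1) * fourier 1 : C(UnitCirc, ℂ)) = 1 := by
      rw [fourier_mul_fourier, neg_add_cancel, fourier_zero_eq_one]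
    simp only [star_mul', star_star, star_fourier, neg_neg]
    linear_combination (β.boundary * star v * star α.boundary * u) * h4
  rw [h3] at h1
  change inner ℂ g (β.conjugation (A (α.conjugation f))) = _
  rw [h2, ← modelSpace_inner_conj_symm, h1, inner_conj_symm, inner_mulOp_star, star_toLp, mulOp_toLp]

theorem conjugation_comp_mem_truncatedToeplitz_iff {A : α.modelSpace →ₗ[ℂ] β.modelSpace} :
    A ∈ α.truncatedToeplitz β ↔
      β.conjugation.comp (A.comp α.conjugation) ∈ α.truncatedToeplitz β := by
  refine ⟨conjugation_comp_mem_truncatedToeplitz, fun h => ?_⟩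
  have h1 := conjugation_comp_mem_truncatedToeplitz h
  convert! h1
  ext1 f
  change A f = β.conjugation (β.conjugation (A (α.conjugation (α.conjugation f))))
  rw [conjugation_conjugation, conjugation_conjugation]

/-! ### The displacement equation -/

/-- A displacement equation for rank-one perturbations of `S` and `T` is solvable if and only if
the one for `S` and `T` is, the latter being written in weak form. -/
theorem exists_rankOne_displacement_iff {E F : Type*} [NormedAddCommGroup E] [InnerProductSpace ℂ E]
    [CompleteSpace E] [NormedAddCommGroup F] [InnerProductSpace ℂ F] [CompleteSpace F]
    (A : E →L[ℂ] F) (S : E →L[ℂ] E) (T : F →L[ℂ] F) (k l : E) (m n : F) (a b : ℂ) :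
    (∃ (χ : E) (ψ : F),
      A.toLinearMap -
        (ContinuousLinearMap.adjoint (T + b • InnerProductSpace.rankOne ℂ m n)).toLinearMap ∘ₗ
        A.toLinearMap ∘ₗ (S + a • InnerProductSpace.rankOne ℂ k l).toLinearMap =
        (InnerProductSpace.rankOne ℂ ψ l).toLinearMap +
          (InnerProductSpace.rankOne ℂ n χ).toLinearMap) ↔
    ∃ (χ : E) (ψ : F), ∀ f g,
      inner ℂ g (A f) - inner ℂ (T g) (A (S f))
        = inner ℂ l f * inner ℂ g ψ + inner ℂ g n * inner ℂ χ f := by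
  -- `p` and `r` collect the terms of the expanded product carrying `⟨f, l⟩` and `⟨n, g⟩`
  -- respectively. The cross term carries both and is assigned to `p`.
  let p : F := a • ContinuousLinearMap.adjoint T (A k) + (a * conj b * inner ℂ m (A k)) • n
  let r : E := b • ContinuousLinearMap.adjoint S (ContinuousLinearMap.adjoint A m)
  have hS : ∀ f g, inner ℂ ((T + b • InnerProductSpace.rankOne ℂ m n) g)
        (A ((S + a • InnerProductSpace.rankOne ℂ k l) f))
      = inner ℂ (T g) (A (S f)) + inner ℂ l f * inner ℂ g p + inner ℂ g n * inner ℂ r f := by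
    intro f g
    simp only [r, p, _root_.add_apply, _root_.smul_apply, InnerProductSpace.rankOne_apply, map_add,
      map_smul, inner_add_left, inner_add_right, inner_smul_left, inner_smul_right,
      inner_conj_symm, ContinuousLinearMap.adjoint_inner_left,
      ContinuousLinearMap.adjoint_inner_right]
    ring
  have hweak : ∀ (χ : E) (ψ : F),
      A.toLinearMap -
        (ContinuousLinearMap.adjoint (T + b • InnerProductSpace.rankOne ℂ m n)).toLinearMap ∘ₗ
        A.toLinearMap ∘ₗ (S + a • InnerProductSpace.rankOne ℂ k l).toLinearMap =
        (InnerProductSpace.rankOne ℂ ψ l).toLinearMap +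
          (InnerProductSpace.rankOne ℂ n χ).toLinearMap ↔
      ∀ f g, inner ℂ g (A f) - inner ℂ ((T + b • InnerProductSpace.rankOne ℂ m n) g)
          (A ((S + a • InnerProductSpace.rankOne ℂ k l) f))
        = inner ℂ l f * inner ℂ g ψ + inner ℂ g n * inner ℂ χ f := by
    intro χ ψ
    rw [LinearMap.ext_iff]
    refine forall_congr' fun f => ?_
    rw [ext_iff_inner_left ℂ]
    refine forall_congr' fun g => ?_
    rw [LinearMap.sub_apply, inner_sub_right, LinearMap.add_apply, inner_add_right]
    simp only [LinearMap.comp_apply, ContinuousLinearMap.coe_coe, InnerProductSpace.rankOne_apply,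
      ContinuousLinearMap.adjoint_inner_right, inner_smul_right, mul_comm (inner ℂ χ f)]
  simp only [hweak]
  constructor
  · rintro ⟨χ, ψ, h⟩
    refine ⟨χ + r, ψ + p, fun f g => ?_⟩
    rw [inner_add_left, inner_add_right]
    linear_combination h f g + hS f g
  · rintro ⟨χ, ψ, h⟩
    refine ⟨χ - r, ψ - p, fun f g => ?_⟩
    rw [inner_sub_left, inner_sub_right]
    linear_combination h f g - hS f g

/-- The displacement equation for the modified shifts holds for some pair of vectors if and only if
it does, in its weak form, for the compressed shifts. -/
theorem exists_displacement_iff (a b : ℂ) (A : α.modelSpace →ₗ[ℂ] β.modelSpace) :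
    (∃ (χ : α.modelSpace) (ψ : β.modelSpace),
      A - (ContinuousLinearMap.adjoint (β.modifiedShift b)).toLinearMap ∘ₗ A ∘ₗ
          (α.modifiedShift a).toLinearMap =
        (InnerProductSpace.rankOne ℂ ψ α.conjKernel).toLinearMap +
          (InnerProductSpace.rankOne ℂ β.conjKernel χ).toLinearMap) ↔
    ∃ (χ : α.modelSpace) (ψ : β.modelSpace), ∀ f g,
      inner ℂ g (A f) - inner ℂ (β.compressedShift g) (A (α.compressedShift f))
        = inner ℂ α.conjKernel f * inner ℂ g ψ + inner ℂ g β.conjKernel * inner ℂ χ f :=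
  exists_rankOne_displacement_iff (LinearMap.toContinuousLinearMap A) α.compressedShift
    β.compressedShift α.kernel α.conjKernel β.kernel β.conjKernel a b

/-! ### The displacement of an operator with a given symbol -/

/-- The scalars `c` and `d` stand for the coefficients of `α` and `β` in the two shifted functions.
Since `z z̄ = 1`, the term free of both cancels. -/
theorem inner_contL2_sub_shift (φ : L2Circ) (u v : C(UnitCirc, ℂ)) (c d : ℂ) :
    inner ℂ (contL2 (v * star u)) φ
      - inner ℂ (contL2 ((fourier 1 * v - d • β.boundary)
          * star (fourier 1 * u - c • α.boundary))) φ
      = c * inner ℂ (contL2 v) (mulOp (α.boundary * fourier (-1)) φ)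
        + conj d * inner ℂ (β.conjL2 φ) (contL2 u)
        - conj d * c * inner ℂ (contL2 β.boundary) (mulOp α.boundary φ) := by
  have h4 : (fourier 1 * fourier (-1) : C(UnitCirc, ℂ)) = 1 := by
    rw [fourier_mul_fourier, add_neg_cancel, fourier_zero_eq_one]
  have h5 : (fourier 1 * v - d • β.boundary) * star (fourier 1 * u - c • α.boundary)
      = v * star u - conj c • (v * star (α.boundary * fourier (-1)))
        - d • (β.boundary * fourier (-1) * star u)
        + (d * conj c) • (β.boundary * star α.boundary) := by
    simp only [star_sub, star_mul', star_smul, star_fourier, neg_neg, RCLike.star_def, sub_mul,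
      mul_sub, smul_mul_assoc, mul_smul_comm, smul_sub, smul_smul]
    rw [show fourier 1 * v * (fourier (-1) * star u) = (fourier 1 * fourier (-1)) * (v * star u) by
      ring, h4, one_mul, show fourier 1 * v * star α.boundary = v * (star α.boundary * fourier 1) by
      ring, show β.boundary * (fourier (-1) * star u) = β.boundary * fourier (-1) * star u by ring]
    rw [mul_comm (conj c) d]
    abel
  rw [h5]
  simp only [contL2, map_add, map_sub, map_smul, inner_add_left, inner_sub_left, inner_smul_left,
    map_mul, Complex.conj_conj]
  rw [conjL2_inner, conjL2_contL2, inner_contL2_mulOp, inner_contL2_mulOp]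
  ring

theorem compressedShift_coe_contL2 {f : α.modelSpace} {u : C(UnitCirc, ℂ)}
    (hu : (f : L2Circ) = contL2 u) : (α.compressedShift f : L2Circ)
      = contL2 (fourier 1 * u - inner ℂ α.conjKernel f • α.boundary) := by
  rw [compressedShift_coe, hu, mulOp_toLp, ← map_smul, ← map_sub]

/-- The displacement of the truncated Toeplitz operator with symbol `φ`, in weak form. -/
theorem displacement_of_symbol {A : α.modelSpace →ₗ[ℂ] β.modelSpace} {φ : L2Circ}
    (hA : ∀ (u v : C(UnitCirc, ℂ)) (f : α.modelSpace) (g : β.modelSpace),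
      (f : L2Circ) = contL2 u → (g : L2Circ) = contL2 v →
      inner ℂ g (A f) = inner ℂ (contL2 (v * star u)) φ) (f : α.modelSpace) (g : β.modelSpace) :
    inner ℂ g (A f) - inner ℂ (β.compressedShift g) (A (α.compressedShift f))
      = inner ℂ α.conjKernel f * inner ℂ (g : L2Circ) (mulOp (α.boundary * fourier (-1)) φ)
        + inner ℂ g β.conjKernel * inner ℂ (β.conjL2 φ) (f : L2Circ)
        - inner ℂ g β.conjKernel * inner ℂ α.conjKernel f
          * inner ℂ (contL2 β.boundary) (mulOp α.boundary φ) := by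
  obtain ⟨u, hu⟩ := α.exists_eq_contL2 f.2
  obtain ⟨v, hv⟩ := β.exists_eq_contL2 g.2
  rw [hA u v f g hu hv, hA _ _ _ _ (compressedShift_coe_contL2 hu) (compressedShift_coe_contL2 hv),
    inner_contL2_sub_shift, hu, hv, modelSpace_inner_conj_symm]

theorem exists_displacement_of_mem {A : α.modelSpace →ₗ[ℂ] β.modelSpace}
    (hA : A ∈ α.truncatedToeplitz β) :
    ∃ (χ : α.modelSpace) (ψ : β.modelSpace), ∀ f g,
      inner ℂ g (A f) - inner ℂ (β.compressedShift g) (A (α.compressedShift f))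
        = inner ℂ α.conjKernel f * inner ℂ g ψ + inner ℂ g β.conjKernel * inner ℂ χ f := by
  obtain ⟨φ, hφ⟩ := mem_truncatedToeplitz_iff.mp hA
  -- The term containing both `⟨f, k̃₀⟩` and `⟨k̃₀, g⟩` is absorbed into `ψ` as a multiple of `k̃₀`.
  refine ⟨α.proj (β.conjL2 φ), β.proj (mulOp (α.boundary * fourier (-1)) φ)
    - inner ℂ (contL2 β.boundary) (mulOp α.boundary φ) • β.conjKernel, fun f g => ?_⟩
  rw [displacement_of_symbol hφ, proj_inner, inner_sub_right, modelSpace_inner_smul_right,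
    inner_proj]
  ring

/-! ### A symbol with prescribed displacement -/

/-- `⟨β h, z g⟩` for `h ∈ H²` and `g ∈ K_β`, with the arguments exchanged. -/
theorem inner_mulOp_fourier_mulOp_boundary {h g : L2Circ} (hh : h ∈ hardySpace)
    (hg : g ∈ β.modelSpace) :
    inner ℂ (mulOp (fourier 1) g) (mulOp β.boundary h)
      = inner ℂ g (β.conjKernel : L2Circ) * inner ℂ (fourierLp 2 0) h := by
  rw [← inner_conj_symm, β.inner_mulOp_boundary_mulOp_fourier hh hg, map_mul, inner_conj_symm,
    inner_conj_symm]

variable (α β) in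
/-- The truncated Toeplitz operator with continuous symbol `w`. -/
def toeplitzOp (w : C(UnitCirc, ℂ)) : α.modelSpace →ₗ[ℂ] β.modelSpace :=
  (β.proj ∘L mulOp w ∘L α.modelSpace.subtypeL).toLinearMap

theorem inner_toeplitzOp (w u v : C(UnitCirc, ℂ)) (f : α.modelSpace) (g : β.modelSpace)
    (hu : (f : L2Circ) = contL2 u) (hv : (g : L2Circ) = contL2 v) :
    inner ℂ g (α.toeplitzOp β w f) = inner ℂ (contL2 (v * star u)) (contL2 w) := by
  change inner ℂ g (β.proj (mulOp w f)) = _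
  rw [inner_proj, hu, hv, mulOp_toLp, mul_comm w, ← mulOp_toLp, inner_contL2_mulOp]

variable (α β) in
/-- A symbol whose truncated Toeplitz operator has displacement `ψ ⊗ k̃₀ + k̃₀ ⊗ χ`. -/
def displacementSymbol (χ ψ : L2Circ) : L2Circ :=
  -- By `displacement_of_symbol`, the displacement depends on `C_β φ` and `α z̄ φ`. The first
  -- summand is sent to `χ` by `C_β`, the second to `ψ` by `α z̄`; what else they produce cancels.
  β.conjL2 χ + mulOp (star α.boundary * fourier 1) ψ

/-- Continuity of the symbol makes multiplication by it bounded on all of `L²`, as `toeplitzOp`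
requires. -/
theorem exists_displacementSymbol_eq_contL2 (χ : α.modelSpace) (ψ : β.modelSpace) :
    ∃ w : C(UnitCirc, ℂ), α.displacementSymbol β χ ψ = contL2 w := by
  obtain ⟨x, hx⟩ := α.exists_eq_contL2 χ.2
  obtain ⟨y, hy⟩ := β.exists_eq_contL2 ψ.2
  refine ⟨β.boundary * fourier (-1) * star x + star α.boundary * fourier 1 * y, ?_⟩
  rw [displacementSymbol, hx, hy, conjL2_contL2, mulOp_toLp, ← map_add]

theorem mulOp_boundary_conjL2 (χ : L2Circ) :
    mulOp α.boundary (β.conjL2 χ) = mulOp β.boundary (α.conjL2 χ) := by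
  rw [conjL2_apply, conjL2_apply, mulOp_mulOp, mulOp_mulOp, mul_left_comm α.boundary]

theorem conjL2_mulOp (u : C(UnitCirc, ℂ)) (f : L2Circ) :
    β.conjL2 (mulOp u f) = mulOp (star u) (β.conjL2 f) := by
  rw [conjL2_apply, conjL2_apply, star_mulOp, mulOp_mulOp, mulOp_mulOp, mul_comm (star u)]

theorem mulOp_boundary_displacementSymbol (χ ψ : L2Circ) :
    mulOp α.boundary (α.displacementSymbol β χ ψ)
      = mulOp β.boundary (α.conjL2 χ) + mulOp (fourier 1) ψ := by
  have h : α.boundary * (star α.boundary * fourier 1) = fourier 1 := by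
    rw [← mul_assoc, boundary_mul_star, one_mul]
  rw [displacementSymbol, map_add, mulOp_boundary_conjL2, mulOp_mulOp α.boundary, h]

theorem conjL2_displacementSymbol (χ ψ : L2Circ) :
    β.conjL2 (α.displacementSymbol β χ ψ)
      = χ + mulOp (fourier (-1)) (mulOp α.boundary (β.conjL2 ψ)) := by
  rw [displacementSymbol, map_add, conjL2_conjL2, conjL2_mulOp, star_mul', star_star, star_fourier,
    mulOp_mulOp, mul_comm α.boundary]

/-- Besides `ψ`, the symbol contributes `z̄ β C_α χ`; since `C_α χ ∈ H²`, elements of `K_β` see it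
only as a multiple of `k̃₀`. -/
theorem inner_mulOp_displacementSymbol (χ : α.modelSpace) (ψ g : β.modelSpace) :
    inner ℂ (g : L2Circ) (mulOp (α.boundary * fourier (-1)) (α.displacementSymbol β χ ψ))
      = inner ℂ g β.conjKernel * inner ℂ (fourierLp 2 0) (α.conjL2 χ) + inner ℂ g ψ := by
  rw [mul_comm α.boundary, ← mulOp_mulOp, mulOp_boundary_displacementSymbol, inner_mulOp_right,
    star_fourier, neg_neg, inner_add_right,
    inner_mulOp_fourier_mulOp_boundary (α.mem_modelSpace.mp (α.conjL2_mem χ.2)).1 g.2,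
    inner_mulOp_left, mulOp_mulOp, star_fourier, fourier_mul_fourier, neg_add_cancel,
    fourier_zero_eq_one, mulOp_one, Submodule.coe_inner, Submodule.coe_inner]

theorem conjL2_displacementSymbol_inner (χ f : α.modelSpace) (ψ : β.modelSpace) :
    inner ℂ (β.conjL2 (α.displacementSymbol β χ ψ)) (f : L2Circ)
      = inner ℂ χ f + inner ℂ α.conjKernel f * inner ℂ (β.conjL2 ψ) (fourierLp 2 0) := by
  rw [conjL2_displacementSymbol, inner_add_left, inner_mulOp_left (fourier (-1)),
    star_fourier, neg_neg, α.inner_mulOp_boundary_mulOp_fourier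
      (β.mem_modelSpace.mp (β.conjL2_mem ψ.2)).1 f.2, Submodule.coe_inner, Submodule.coe_inner]

/-- This constant is the sum of the two unwanted constants from `inner_mulOp_displacementSymbol` and
`conjL2_displacementSymbol_inner`. It enters the displacement with a minus sign and cancels both. -/
theorem inner_boundary_displacementSymbol (χ ψ : L2Circ) :
    inner ℂ (contL2 β.boundary) (mulOp α.boundary (α.displacementSymbol β χ ψ))
      = inner ℂ (fourierLp 2 0) (α.conjL2 χ) + inner ℂ (β.conjL2 ψ) (fourierLp 2 0) := by
  rw [mulOp_boundary_displacementSymbol, inner_add_right, conjL2_inner, inner_contL2_mulOp,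
    inner_contL2_mulOp, boundary_mul_star, star_fourier, fourierLp, conjL2_contL2,
    fourier_zero_eq_one, star_one, mul_one]

theorem mem_of_displacement {A : α.modelSpace →ₗ[ℂ] β.modelSpace}
    {χ : α.modelSpace} {ψ : β.modelSpace} (h : ∀ f g,
      inner ℂ g (A f) - inner ℂ (β.compressedShift g) (A (α.compressedShift f))
        = inner ℂ α.conjKernel f * inner ℂ g ψ + inner ℂ g β.conjKernel * inner ℂ χ f) :
    A ∈ α.truncatedToeplitz β := by
  obtain ⟨w, hw⟩ := exists_displacementSymbol_eq_contL2 χ ψ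
  have hAw : A = α.toeplitzOp β w := by
    -- Both operators have the same displacement, so their difference solves the homogeneous Stein
    -- equation.
    refine sub_eq_zero.mp (α.eq_zero_of_inner_compressedShift β fun f g => ?_)
    have h1 := displacement_of_symbol (α.inner_toeplitzOp (β := β) w) f g
    rw [← hw, inner_mulOp_displacementSymbol, conjL2_displacementSymbol_inner,
      inner_boundary_displacementSymbol] at h1
    rw [LinearMap.sub_apply, LinearMap.sub_apply, inner_sub_right, inner_sub_right]
    linear_combination h f g - h1
  rw [hAw]
  exact mem_truncatedToeplitz_iff.mpr ⟨contL2 w, inner_toeplitzOp w⟩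

end FiniteBlaschkeProduct

end

theorem mainTheorem2 (α β : FiniteBlaschkeProduct) (a b : ℂ)
    (A : α.modelSpace →ₗ[ℂ] β.modelSpace) :
    (A ∈ α.truncatedToeplitz β ↔
      ∃ (χ : α.modelSpace) (ψ : β.modelSpace),
        A - (ContinuousLinearMap.adjoint (β.modifiedShift b)).toLinearMap ∘ₗ A ∘ₗ
            (α.modifiedShift a).toLinearMap =
          (InnerProductSpace.rankOne ℂ ψ α.conjKernel).toLinearMap +
            (InnerProductSpace.rankOne ℂ β.conjKernel χ).toLinearMap) ∧
    (A ∈ α.truncatedToeplitz β ↔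
      β.conjugation.comp (A.comp α.conjugation) ∈ α.truncatedToeplitz β) := by
  refine ⟨?_, FiniteBlaschkeProduct.conjugation_comp_mem_truncatedToeplitz_iff⟩
  rw [FiniteBlaschkeProduct.exists_displacement_iff a b A]
  refine ⟨FiniteBlaschkeProduct.exists_displacement_of_mem, ?_⟩
  rintro ⟨χ, ψ, h⟩
  exact FiniteBlaschkeProduct.mem_of_displacement h
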